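/- Let $X$ be a $T_1$ topological space and let $\mathcal A$ be an ideal of closed subsets of $X$, i.e. a family of nonempty closed subsets of $X$ that is closed under binary unions and contains every singleton $\{x\}$, $x\in X$. Let $\operatorname{cof}(\mathcal A;\mathcal A,\subseteq)$ be the least cardinality of a subfamily $\mathcal F\subseteq\mathcal A$ such that every $A\in\mathcal A$ is contained in some member of $\mathcal F$. A map $\Phi$ assigning to every $x\in X$ a nonempty compact set $\Phi(x)\subseteq\mathbb R$ is *usco* if $\{x\in X:\Phi(x)\subseteq V\}$ is open for every open $V\subseteq\mathbb R$; it is *minimal usco* if its graph $\{(x,y): y\in\Phi(x)\}$ properly contains the graph of no usco map. Let $MU_{\mathcal A}(X)$ be the set of all minimal usco maps from $X$ to $\mathbb R$ with the topology of uniform convergence on the members of $\mathcal A$: the topology of the uniformity generated by the sets $$\mathbf W(A,\varepsilon)=\Bigl\{(\Phi,\Psi): \forall x\in A\ \bigl[\Phi(x)\subseteq\textstyle\bigcup_{y\in\Psi(x)}(y-\varepsilon,y+\varepsilon)\ \text{ and }\ \Psi(x)\subseteq\bigcup_{y\in\Phi(x)}(y-\varepsilon,y+\varepsilon)\bigr]\Bigr\},\quad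 A\in\mathcal A,\ \varepsilon>0.$$ Then: 1. if $\operatorname{cof}(\mathcal A;\mathcal A,\subseteq)\le\omega$, then $MU_{\mathcal A}(X)$ is metrizable; 2. if $X$ is moreover regular, then $\operatorname{cof}(\mathcal A;\mathcal A,\subseteq)\le\omega$ if and only if $MU_{\mathcal A}(X)$ is metrizable. -/

import Mathlib

open Set Topology TopologicalSpace Uniformity UniformConvergence Cardinal

universe u v

/-- An ideal of closed subsets of `X`: a family of nonempty closed sets which is closed under
binary unions and contains all singletons. -/
structure IsClosedIdeal {X : Type u} [TopologicalSpace X] (𝒜 : Set (Set X)) : Prop where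
  nonempty : ∀ A ∈ 𝒜, A.Nonempty
  isClosed : ∀ A ∈ 𝒜, IsClosed A
  union_mem : ∀ A ∈ 𝒜, ∀ B ∈ 𝒜, A ∪ B ∈ 𝒜
  singleton_mem : ∀ x : X, {x} ∈ 𝒜

/-- The cofinality of `𝒜` relative to `ℬ` in an ordered set `P`: the least cardinality of a
subfamily `ℱ` of `𝒜` such that every `B ∈ ℬ` lies below some `A ∈ ℱ`. -/
noncomputable def relCof {P : Type u} [LE P] (𝒜 ℬ : Set P) : Cardinal.{u} :=
  sInf {κ | ∃ ℱ : Set P, ℱ ⊆ 𝒜 ∧ #ℱ = κ ∧ ∀ B ∈ ℬ, ∃ A ∈ ℱ, B ≤ A}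

section Usco

variable {X : Type u} {Y : Type v}

/-- An usco map from `X` to `Y`: an upper semicontinuous map whose values are nonempty compact
sets.  Upper semicontinuity says that `{x | Φ x ⊆ V}` is open for every open `V ⊆ Y`. -/
def IsUsco [TopologicalSpace X] [TopologicalSpace Y] (Φ : X → NonemptyCompacts Y) : Prop :=
  UpperHemicontinuous fun x => (Φ x : Set Y)

/-- The graph of a set-valued map. -/
def uscoGraph [TopologicalSpace Y] (Φ : X → NonemptyCompacts Y) : Set (X × Y) :=
  {p | p.2 ∈ Φ p.1}

/-- A minimal usco map: an usco map whose graph contains the graph of no other usco map. -/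
def IsMinimalUsco [TopologicalSpace X] [TopologicalSpace Y] (Φ : X → NonemptyCompacts Y) : Prop :=
  IsUsco Φ ∧ ∀ Ψ : X → NonemptyCompacts Y, IsUsco Ψ →
    uscoGraph Ψ ⊆ uscoGraph Φ → uscoGraph Ψ = uscoGraph Φ

/-- The set of minimal usco maps from `X` to `ℝ`, with the uniformity (and the topology) of
uniform convergence on the members of `𝒜`.  Here `NonemptyCompacts ℝ` carries its Hausdorff
uniformity; see `hasBasis_uniformity_minimalUscoOn` for a base of the uniformity. -/
abbrev MinimalUscoOn (X : Type u) [TopologicalSpace X] (𝒜 : Set (Set X)) : Type u :=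
  {Φ : X →ᵤ[𝒜] NonemptyCompacts ℝ // IsMinimalUsco (UniformOnFun.toFun 𝒜 Φ)}

/-- The value of a minimal usco map at a point, as a set of reals. -/
def MinimalUscoOn.val [TopologicalSpace X] {𝒜 : Set (Set X)} (Φ : MinimalUscoOn X 𝒜) (x : X) :
    Set ℝ :=
  (UniformOnFun.toFun 𝒜 Φ.1 x : NonemptyCompacts ℝ)

theorem isUsco_iff [TopologicalSpace X] [TopologicalSpace Y] (Φ : X → NonemptyCompacts Y) :
    IsUsco Φ ↔ ∀ V : Set Y, IsOpen V → IsOpen {x | (Φ x : Set Y) ⊆ V} :=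
  upperHemicontinuous_iff_isOpen_preimage_Iic

/-- For a nonempty ideal `𝒜`, the sets of pairs `(Φ, Ψ)` such that, for all `x ∈ A`, `Φ x` and
`Ψ x` lie in each other's open `ε`-neighbourhoods, where `A ∈ 𝒜` and `ε > 0`, are a base for the
uniformity on `MinimalUscoOn X 𝒜`. -/
theorem hasBasis_uniformity_minimalUscoOn [TopologicalSpace X] {𝒜 : Set (Set X)}
    (h𝒜 : IsClosedIdeal 𝒜) (hne : 𝒜.Nonempty) :
    (𝓤 (MinimalUscoOn X 𝒜)).HasBasis (fun p : Set X × ℝ => p.1 ∈ 𝒜 ∧ 0 < p.2)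
      (fun p => {q | ∀ x ∈ p.1,
        q.1.val x ⊆ Metric.thickening p.2 (q.2.val x) ∧
        q.2.val x ⊆ Metric.thickening p.2 (q.1.val x)}) := by
  have hdir : DirectedOn (· ⊆ ·) 𝒜 := fun A hA B hB =>
    ⟨A ∪ B, h𝒜.union_mem A hA B hB, subset_union_left, subset_union_right⟩
  have hb : (𝓤 (NonemptyCompacts ℝ)).HasBasis (fun ε : ℝ => 0 < ε) (fun ε =>
      {q | (q.1 : Set ℝ) ⊆ Metric.thickening ε (q.2 : Set ℝ) ∧
        (q.2 : Set ℝ) ⊆ Metric.thickening ε (q.1 : Set ℝ)}) := by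
    refine (Metric.uniformity_basis_dist (α := ℝ)).uniformity_nonemptyCompacts.congr
      (fun _ => Iff.rfl) ?_
    intro ε _
    ext ⟨K, L⟩
    simp only [mem_preimage, mem_hausdorffEntourage, mem_ofPred_eq, Set.subset_def,
      Metric.mem_thickening_iff, SetRel.mem_preimage, SetRel.mem_image, Prod.map]
    simp only [dist_comm]
  exact (UniformOnFun.hasBasis_uniformity_of_basis X (NonemptyCompacts ℝ) 𝒜 hne hdir hb).comap _

end Usco

/-! A countable cofinal family in `𝒜` can be made increasing by finite unions, which gives the
uniformity a countable base; it is Hausdorff because singletons cover `X`. Conversely, a countable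
neighbourhood base at the zero map involves only countably many members of `𝒜`. They are cofinal: if
one fails to contain a point of `B`, regularity yields a step map that is zero on it but takes the
value 2 at that point (`relCof_le_of_firstCountable`). -/

/-- The set-valued map which is `{0, 2}`-valued, takes the value `2` on the closed set `C`, and
the value `0` on the closure of the complement of `C`. -/
def stepUsco {X : Type u} [TopologicalSpace X] (C : Set X) (z : X) : NonemptyCompacts ℝ where
  carrier := {y | (y = 0 ∧ z ∈ closure Cᶜ) ∨ (y = 2 ∧ z ∈ C)}
  isCompact' := (Set.Finite.subset (Set.toFinite {(0 : ℝ), 2}) (by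
    rintro y (⟨h, -⟩ | ⟨h, -⟩) <;> simp [h])).isCompact
  nonempty' := by
    by_cases h : z ∈ C
    · exact ⟨2, Or.inr ⟨rfl, h⟩⟩
    · exact ⟨0, Or.inl ⟨rfl, subset_closure h⟩⟩

theorem mem_stepUsco {X : Type u} [TopologicalSpace X] {C : Set X} {z : X} {y : ℝ} :
    y ∈ stepUsco C z ↔ (y = 0 ∧ z ∈ closure Cᶜ) ∨ (y = 2 ∧ z ∈ C) :=
  Iff.rfl

theorem isUsco_stepUsco {X : Type u} [TopologicalSpace X] {C : Set X} (hC : IsClosed C) :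
    IsUsco (stepUsco C) := by
  rw [isUsco_iff]
  intro V _
  have h : {x | (stepUsco C x : Set ℝ) ⊆ V} =
      {x | (0 : ℝ) ∈ V ∨ x ∈ (closure Cᶜ)ᶜ} ∩ {x | (2 : ℝ) ∈ V ∨ x ∈ Cᶜ} := by
    ext x
    simp only [Set.subset_def, SetLike.mem_coe, mem_stepUsco, mem_inter_iff, mem_ofPred_eq,
      mem_compl_iff]
    constructor
    · intro h
      exact ⟨or_iff_not_imp_right.2 fun hx => h 0 (Or.inl ⟨rfl, not_not.1 hx⟩),
        or_iff_not_imp_right.2 fun hx => h 2 (Or.inr ⟨rfl, not_not.1 hx⟩)⟩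
    · rintro ⟨h₀, h₂⟩ y (⟨rfl, hx⟩ | ⟨rfl, hx⟩)
      · exact h₀.resolve_right (not_not.2 hx)
      · exact h₂.resolve_right (not_not.2 hx)
  rw [h]
  exact (isOpen_const.union isClosed_closure.isOpen_compl).inter
    (isOpen_const.union hC.isOpen_compl)

/-- If `Ψ` is usco and `y ∈ Ψ x` for all `x` in a set `U`, then `y ∈ Ψ z` for all `z` in the
closure of `U`. -/
theorem IsUsco.mem_of_mem_closure {X : Type u} {Y : Type v} [TopologicalSpace X]
    [TopologicalSpace Y] [T1Space Y] {Ψ : X → NonemptyCompacts Y} (hΨ : IsUsco Ψ) {U : Set X}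
    {y : Y} (hU : ∀ x ∈ U, y ∈ Ψ x) {z : X} (hz : z ∈ closure U) : y ∈ Ψ z := by
  by_contra hy
  obtain ⟨x, hx, hxU⟩ := mem_closure_iff.1 hz _
    ((isUsco_iff Ψ).1 hΨ {y}ᶜ isOpen_compl_singleton) (fun w hw h => hy (h ▸ hw))
  exact hx (hU x hxU) rfl

/-- A smaller usco map must be `{0}` off `C` and `{2}` on the interior of `C`; upper semicontinuity
carries these values to the closures, and the second closure is all of `C`. -/
theorem isMinimalUsco_stepUsco {X : Type u} [TopologicalSpace X] {C : Set X}
    (hC : closure (interior C) = C) : IsMinimalUsco (stepUsco C) := by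
  refine ⟨isUsco_stepUsco (hC ▸ isClosed_closure), fun Ψ hΨ hsub => hsub.antisymm ?_⟩
  have hmem : ∀ x y, y ∈ Ψ x → (y = 0 ∧ x ∈ closure Cᶜ) ∨ (y = 2 ∧ x ∈ C) := fun x y hy =>
    mem_stepUsco.1 (hsub (show (x, y) ∈ uscoGraph Ψ from hy))
  rintro ⟨z, y⟩ (⟨h, hz⟩ | ⟨h, hz⟩)
  · obtain rfl : y = 0 := h
    refine hΨ.mem_of_mem_closure (fun x hx => ?_) hz
    obtain ⟨w, hw⟩ := (Ψ x).nonempty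
    rcases hmem x w hw with ⟨rfl, -⟩ | ⟨-, h⟩
    exacts [hw, absurd h hx]
  · obtain rfl : y = 2 := h
    have hz' : z ∈ closure (interior C) := hC.symm ▸ hz
    refine hΨ.mem_of_mem_closure (fun x hx => ?_) hz'
    obtain ⟨w, hw⟩ := (Ψ x).nonempty
    rcases hmem x w hw with ⟨-, h⟩ | ⟨rfl, -⟩
    exacts [absurd hx (by simpa [closure_compl] using h), hw]

/-- The minimal usco map given by `stepUsco`, as an element of the function space. -/
def MinimalUscoOn.step {X : Type u} [TopologicalSpace X] (𝒜 : Set (Set X)) (C : Set X)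
    (hC : closure (interior C) = C) : MinimalUscoOn X 𝒜 :=
  ⟨UniformOnFun.ofFun 𝒜 (stepUsco C), isMinimalUsco_stepUsco hC⟩

theorem MinimalUscoOn.mem_val_step {X : Type u} [TopologicalSpace X] {𝒜 : Set (Set X)}
    {C : Set X} {hC : closure (interior C) = C} {z : X} {y : ℝ} :
    y ∈ (MinimalUscoOn.step 𝒜 C hC).val z ↔ (y = 0 ∧ z ∈ closure Cᶜ) ∨ (y = 2 ∧ z ∈ C) :=
  Iff.rfl

theorem relCof_le_mk {P : Type u} [LE P] {𝒜 ℬ ℱ : Set P} (hℱ : ℱ ⊆ 𝒜)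
    (h : ∀ B ∈ ℬ, ∃ A ∈ ℱ, B ≤ A) : relCof 𝒜 ℬ ≤ #ℱ :=
  csInf_le' ⟨ℱ, hℱ, rfl, h⟩

theorem exists_countable_of_relCof_le {P : Type u} [Preorder P] {𝒜 : Set P}
    (h : relCof 𝒜 𝒜 ≤ ℵ₀) :
    ∃ ℱ ⊆ 𝒜, ℱ.Countable ∧ ∀ B ∈ 𝒜, ∃ A ∈ ℱ, B ≤ A := by
  obtain ⟨ℱ, hℱ, hcard, hcof⟩ := csInf_mem (s := {κ | ∃ ℱ : Set P, ℱ ⊆ 𝒜 ∧ #ℱ = κ ∧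
    ∀ B ∈ 𝒜, ∃ A ∈ ℱ, B ≤ A}) ⟨_, 𝒜, Subset.rfl, rfl, fun B hB => ⟨B, hB, le_rfl⟩⟩
  exact ⟨ℱ, hℱ, le_aleph0_iff_set_countable.1 (hcard.trans_le h), hcof⟩

theorem IsClosedIdeal.exists_monotone_cofinal {X : Type u} [TopologicalSpace X]
    {𝒜 : Set (Set X)} (h𝒜 : IsClosedIdeal 𝒜) (hne : 𝒜.Nonempty) (h : relCof 𝒜 𝒜 ≤ ℵ₀) :
    ∃ t : ℕ → Set X, (∀ n, t n ∈ 𝒜) ∧ Monotone t ∧ ∀ A ∈ 𝒜, ∃ n, A ⊆ t n := by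
  obtain ⟨ℱ, hℱ, hcount, hcof⟩ := exists_countable_of_relCof_le h
  obtain ⟨A₀, hA₀⟩ := hne
  obtain ⟨F₀, hF₀, -⟩ := hcof A₀ hA₀
  obtain ⟨f, rfl⟩ := hcount.exists_eq_range ⟨F₀, hF₀⟩
  refine ⟨partialSups f, fun n => ?_, (partialSups f).monotone, fun A hA => ?_⟩
  · induction n with
    | zero => simpa using hℱ (mem_range_self 0)
    | succ n ih =>
      rw [partialSups_add_one]
      exact h𝒜.union_mem _ ih _ (hℱ (mem_range_self _))
  · obtain ⟨_, ⟨n, rfl⟩, hn⟩ := hcof A hA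
    exact ⟨n, hn.trans (le_partialSups f n)⟩

theorem metrizableSpace_minimalUscoOn {X : Type u} [TopologicalSpace X]
    {𝒜 : Set (Set X)} (h𝒜 : IsClosedIdeal 𝒜) (h : relCof 𝒜 𝒜 ≤ ℵ₀) :
    MetrizableSpace (MinimalUscoOn X 𝒜) := by
  have hcover : ⋃₀ 𝒜 = Set.univ :=
    eq_univ_of_forall fun x => ⟨{x}, h𝒜.singleton_mem x, rfl⟩
  have : T2Space (X →ᵤ[𝒜] NonemptyCompacts ℝ) := UniformOnFun.t2Space_of_covering hcover
  rcases 𝒜.eq_empty_or_nonempty with rfl | hne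
  · have : IsEmpty X := by
      rw [← univ_eq_empty_iff, ← hcover, sUnion_empty]
    have : Subsingleton (X →ᵤ[(∅ : Set (Set X))] NonemptyCompacts ℝ) :=
      inferInstanceAs (Subsingleton (X → NonemptyCompacts ℝ))
    infer_instance
  obtain ⟨t, ht, hmono, hex⟩ := h𝒜.exists_monotone_cofinal hne h
  have : (𝓤 (X →ᵤ[𝒜] NonemptyCompacts ℝ)).IsCountablyGenerated :=
    UniformOnFun.isCountablyGenerated_uniformity 𝒜 ht hmono hex
  have : (𝓤 (MinimalUscoOn X 𝒜)).IsCountablyGenerated := Filter.comap.isCountablyGenerated _ _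
  exact UniformSpace.metrizableSpace

theorem relCof_le_of_firstCountable {X : Type u} [TopologicalSpace X] [RegularSpace X]
    {𝒜 : Set (Set X)} (h𝒜 : IsClosedIdeal 𝒜) [FirstCountableTopology (MinimalUscoOn X 𝒜)] :
    relCof 𝒜 𝒜 ≤ ℵ₀ := by
  rcases 𝒜.eq_empty_or_nonempty with rfl | hne
  · exact (relCof_le_mk Subset.rfl (by simp)).trans (by simp)
  -- This is the constant map `{0}`.
  let Φ₀ : MinimalUscoOn X 𝒜 := MinimalUscoOn.step 𝒜 ∅ (by simp)
  have hU := hasBasis_uniformity_minimalUscoOn h𝒜 hne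
  have hN := nhds_basis_uniformity' hU (x := Φ₀)
  obtain ⟨p, hp, hbasis⟩ := hN.exists_antitone_subbasis
  refine (relCof_le_mk (ℱ := range fun n => (p n).1) ?_ ?_).trans
    (le_aleph0_iff_set_countable.2 (countable_range _))
  · rintro _ ⟨n, rfl⟩
    exact (hp n).1
  intro B hB
  obtain ⟨n, hn⟩ := hbasis.mem_iff.1 (hN.mem_of_mem (i := (B, 1)) ⟨hB, one_pos⟩)
  refine ⟨_, mem_range_self n, fun x hxB => ?_⟩
  by_contra hxA
  obtain ⟨C, hCx, hCclosed, hCA⟩ := exists_mem_nhds_isClosed_subset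
    ((h𝒜.isClosed _ (hp n).1).isOpen_compl.mem_nhds hxA)
  -- Passing to the regular closed part of `C` makes the step map minimal.
  have hsub : closure (interior C) ⊆ C := hCclosed.closure_interior_subset
  let Φ : MinimalUscoOn X 𝒜 := MinimalUscoOn.step 𝒜 (closure (interior C))
    closure_interior_idem
  have hmem : Φ ∈ UniformSpace.ball Φ₀ {q | ∀ x ∈ (p n).1,
      q.1.val x ⊆ Metric.thickening (p n).2 (q.2.val x) ∧
      q.2.val x ⊆ Metric.thickening (p n).2 (q.1.val x)} := by
    intro z hz
    have hzC : z ∉ closure (interior C) := fun h => hCA (hsub h) hz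
    have heq : Φ₀.val z = Φ.val z := by
      ext y
      simp only [Φ₀, Φ, MinimalUscoOn.mem_val_step]
      have hz' := subset_closure (show z ∈ (closure (interior C))ᶜ from hzC)
      simp only [hzC, hz', compl_empty, closure_univ, mem_univ, mem_empty_iff_false]
    have hself := Metric.self_subset_thickening (hp n).2 (Φ.val z)
    change Φ₀.val z ⊆ _ ∧ Φ.val z ⊆ Metric.thickening _ (Φ₀.val z)
    rw [heq]
    exact ⟨hself, hself⟩
  have h2 : (2 : ℝ) ∈ Φ.val x := MinimalUscoOn.mem_val_step.2
    (Or.inr ⟨rfl, subset_closure (mem_interior_iff_mem_nhds.2 hCx)⟩)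
  -- The jump 2 exceeds the tolerance 1 chosen for `B`.
  obtain ⟨y, hy, hdist⟩ := Metric.mem_thickening_iff.1 ((hn hmem x hxB).2 h2)
  rcases (MinimalUscoOn.mem_val_step (hC := by simp)).1 hy with ⟨rfl, -⟩ | ⟨-, h⟩
  · norm_num [Real.dist_eq] at hdist
  · exact h

theorem mainTheorem9 {X : Type*} [TopologicalSpace X] [T1Space X] (𝒜 : Set (Set X))
    (h𝒜 : IsClosedIdeal 𝒜) :
    (relCof 𝒜 𝒜 ≤ ℵ₀ → MetrizableSpace (MinimalUscoOn X 𝒜)) ∧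
      (RegularSpace X → (relCof 𝒜 𝒜 ≤ ℵ₀ ↔ MetrizableSpace (MinimalUscoOn X 𝒜))) :=
  ⟨metrizableSpace_minimalUscoOn h𝒜, fun _ =>
    ⟨metrizableSpace_minimalUscoOn h𝒜, fun _ => relCof_le_of_firstCountable h𝒜⟩⟩
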